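/- Let $\mathcal X\subset\mathbb R^d$ be a compact set at every point of which derivatives relative to $\mathcal X$ are uniquely determined (i.e. the tangent directions to $\mathcal X$ at each of its points span a dense subspace of $\mathbb R^d$; this holds for instance if $\mathcal X$ is the closure of an open set with Lipschitz boundary). Let $\Phi:\mathcal X\to\mathbb R^m$ be a continuously differentiable feature map (up to the boundary), with Jacobian $[J\Phi(x)]_{a,j}=\partial\Phi_j(x)/\partial x_a$, $J\Phi(x)\in\mathbb R^{d\times m}$. For a Borel probability measure $\nu$ on $\mathcal X$ put $$\boldsymbol\mu(\nu)=\mathbb E_{x\sim\nu}\,\Phi(x)\in\mathbb R^m,\qquad D(\nu)=\mathbb E_{x\sim\nu}\,[J\Phi(x)]^{\top}J\Phi(x)\in\mathbb R^{m\times m},$$ and for two such measures put $\mathrm{MMD}(\nu_p,\nu_q)=\|\boldsymbol\mu(\nu_p)-\boldsymbol\mu(\nu_q)\|$ and, for $\lambda>0$, $$u^{\lambda}_{p,q}(x)=\big\langle (D(\nu_q)+\lambda I_m)^{-1}(\boldsymbol\mu(\nu_p)-\boldsymbol\mu(\nu_q)),\,\Phi(x)\big\rangle ,\qquad x\in\mathcal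 X$$ (the regularized Sobolev critic). Let $\nu_p$ be a Borel probability measure on $\mathcal X$ that satisfies **(A)** for every Borel probability measure $\nu$ on $\mathcal X$ with $\boldsymbol\mu(\nu_p)-\boldsymbol\mu(\nu)\ne 0$, the vector $\boldsymbol\mu(\nu_p)-\boldsymbol\mu(\nu)$ is not in the null space of $D(\nu)$. Let $\lambda>0$, let $\nu_q$ be a Borel probability measure on $\mathcal X$, and let $(X_t)_{t\ge 0}$ be a continuous regularized Sobolev descent from $\nu_q$ to $\nu_p$ in $\mathcal X$: a family of $\mathbb R^d$-valued random variables on a probability space such that $X_0\sim\nu_q$ and almost surely, for all $t\ge 0$, $X_t\in\mathcal X$ and $$\frac{d}{dt}X_t=\nabla_x u^{\lambda}_{p,q_t}(X_t),$$ where $\nu_{q_t}$ denotes the law of $X_t$ and the derivative at $t=0$ is one-sided. Then $$\lim_{t\to\infty}\mathrm{MMD}(\nu_p,\nu_{q_t})=0 .$$ -/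

import Mathlib

open MeasureTheory Filter Topology Set

noncomputable section

namespace SobolevDescent

variable {d m : ℕ}

/-- `ν` is a probability measure on the set `X ⊆ ℝᵈ`, regarded as a Borel measure on `ℝᵈ` that gives
no mass to the complement of `X`. -/
structure IsProbabilityOn (X : Set (EuclideanSpace ℝ (Fin d)))
    (ν : Measure (EuclideanSpace ℝ (Fin d))) : Prop where
  isProbabilityMeasure : IsProbabilityMeasure ν
  compl_eq_zero : ν Xᶜ = 0

/-- Jacobian `JΦ(x) ∈ ℝ^{d × m}` of a feature map `Φ : X → ℝᵐ`, with entries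
`[JΦ(x)]_{a,j} = ∂Φ_j/∂x_a (x)`. At boundary points it is the derivative relative to `X`. -/
def jacobian (X : Set (EuclideanSpace ℝ (Fin d)))
    (Φ : EuclideanSpace ℝ (Fin d) → EuclideanSpace ℝ (Fin m)) (x : EuclideanSpace ℝ (Fin d)) :
    Matrix (Fin d) (Fin m) ℝ :=
  Matrix.of fun a j => fderivWithin ℝ Φ X x (EuclideanSpace.single a 1) j

/-- Kernel mean embedding `μ(ν) = 𝔼_{x ∼ ν} Φ(x)`. -/
def meanEmbedding (Φ : EuclideanSpace ℝ (Fin d) → EuclideanSpace ℝ (Fin m))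
    (ν : Measure (EuclideanSpace ℝ (Fin d))) : EuclideanSpace ℝ (Fin m) :=
  ∫ x, Φ x ∂ν

/-- Difference of mean embeddings `δ_{p,q} = μ(ν_p) - μ(ν_q)`. -/
def delta (Φ : EuclideanSpace ℝ (Fin d) → EuclideanSpace ℝ (Fin m))
    (νp νq : Measure (EuclideanSpace ℝ (Fin d))) : EuclideanSpace ℝ (Fin m) :=
  meanEmbedding Φ νp - meanEmbedding Φ νq

/-- Maximum mean discrepancy `MMD(ν_p, ν_q) = ‖μ(ν_p) - μ(ν_q)‖`. -/
def MMD (Φ : EuclideanSpace ℝ (Fin d) → EuclideanSpace ℝ (Fin m))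
    (νp νq : Measure (EuclideanSpace ℝ (Fin d))) : ℝ :=
  ‖delta Φ νp νq‖

/-- Kernel derivative Gramian embedding `D(ν) = 𝔼_{x ∼ ν} [JΦ(x)]ᵀ JΦ(x)`, an `m × m` matrix
(expectation taken entrywise). -/
def derivativeGramian (X : Set (EuclideanSpace ℝ (Fin d)))
    (Φ : EuclideanSpace ℝ (Fin d) → EuclideanSpace ℝ (Fin m))
    (ν : Measure (EuclideanSpace ℝ (Fin d))) : Matrix (Fin m) (Fin m) ℝ :=
  Matrix.of fun i j => ∫ x, ((jacobian X Φ x).transpose * jacobian X Φ x) i j ∂ν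

/-- Coefficient vector `(D(ν_q) + lam I)⁻¹ (μ(ν_p) - μ(ν_q)) ∈ ℝᵐ` of the regularized Sobolev
critic. -/
def criticCoeff (X : Set (EuclideanSpace ℝ (Fin d)))
    (Φ : EuclideanSpace ℝ (Fin d) → EuclideanSpace ℝ (Fin m)) (lam : ℝ)
    (νp νq : Measure (EuclideanSpace ℝ (Fin d))) : EuclideanSpace ℝ (Fin m) :=
  Matrix.toEuclideanLin (derivativeGramian X Φ νq + lam • (1 : Matrix (Fin m) (Fin m) ℝ))⁻¹
    (delta Φ νp νq)

/-- The regularized Sobolev critic `u^lam_{p,q}(x) = ⟨(D(ν_q) + lam I)⁻¹ (μ(ν_p) - μ(ν_q)), Φ(x)⟩`,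
a function in the RKHS with feature map `Φ`. -/
def critic (X : Set (EuclideanSpace ℝ (Fin d)))
    (Φ : EuclideanSpace ℝ (Fin d) → EuclideanSpace ℝ (Fin m)) (lam : ℝ)
    (νp νq : Measure (EuclideanSpace ℝ (Fin d))) (x : EuclideanSpace ℝ (Fin d)) : ℝ :=
  inner ℝ (criticCoeff X Φ lam νp νq) (Φ x)

/-- Assumption (A) on the target `ν_p`: for every probability measure `ν_q` on `X`, if
`μ(ν_p) - μ(ν_q) ≠ 0` then it does not lie in the null space of `D(ν_q)`. -/
def AssumptionA (X : Set (EuclideanSpace ℝ (Fin d)))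
    (Φ : EuclideanSpace ℝ (Fin d) → EuclideanSpace ℝ (Fin m))
    (νp : Measure (EuclideanSpace ℝ (Fin d))) : Prop :=
  ∀ νq : Measure (EuclideanSpace ℝ (Fin d)), IsProbabilityOn X νq → delta Φ νp νq ≠ 0 →
    delta Φ νp νq ∉ LinearMap.ker (Matrix.toEuclideanLin (derivativeGramian X Φ νq))

/-- `Y = (Y_t)_{t ≥ 0}` is a continuous regularized Sobolev descent in `X` from the source `ν_q`
towards the target `ν_p`: the particles start with `Y_0 ∼ ν_q`, and almost every particle stays in
`X` and solves `dY_t = ∇ₓ u^lam_{p,q_t}(Y_t) dt` for all `t ≥ 0`, where `ν_{q_t}` is the law of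
`Y_t`. -/
structure IsContinuousDescent {Ω : Type*} [MeasurableSpace Ω] (P : Measure Ω)
    (X : Set (EuclideanSpace ℝ (Fin d)))
    (Φ : EuclideanSpace ℝ (Fin d) → EuclideanSpace ℝ (Fin m)) (lam : ℝ)
    (νp νq : Measure (EuclideanSpace ℝ (Fin d)))
    (Y : ℝ → Ω → EuclideanSpace ℝ (Fin d)) : Prop where
  aemeasurable : ∀ t : ℝ, 0 ≤ t → AEMeasurable (Y t) P
  law_zero : P.map (Y 0) = νq
  mem : ∀ᵐ ω ∂P, ∀ t : ℝ, 0 ≤ t → Y t ω ∈ X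
  flow : ∀ᵐ ω ∂P, ∀ t : ℝ, 0 ≤ t →
    HasDerivWithinAt (fun s => Y s ω)
      (gradientWithin (critic X Φ lam νp (P.map (Y t))) X (Y t ω)) (Ici 0) t

end SobolevDescent

end

/-!
Write `δ` for the difference of mean embeddings and `T` for the operator with matrix `D(ν_{q_t})`.
Along the flow the critic coefficient `c` solves `(T + lam) c = δ`, a particle moves with velocity
`DΦ† c`, and so `Φ` of the particle moves with velocity `DΦ DΦ† c`. Averaging over the particles
(`hasDerivAt_delta`) gives `δ' = -T c`, whence `(‖δ‖²)' = -2 ⟪δ, T c⟫`.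

The dissipation `⟪δ, T c⟫` is bounded below by `‖T δ‖² / (‖T‖ + lam)²`
(`sq_norm_apply_le_of_regularized`), an expression that involves no inverse. Assumption (A) says
that `T δ ≠ 0` as soon as `δ ≠ 0`. To make this uniform, observe that the pairs `(μ(ν), D(ν))`, with
`ν` ranging over the probability measures on `X`, fill out exactly the convex hull of the compact
set `{(Φ x, DΦ(x) DΦ(x)†) | x ∈ X}` (`exists_integral_eq_iff_mem_convexHull`). This is a compact
subset of a finite-dimensional space (`isCompact_convexHull`), so that no weak compactness of
measures is needed, and the bound above attains a positive minimum on the part of it where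
`‖δ‖² ≥ ε` (`exists_pos_le_sq_norm_div`). Hence the dissipation is at least
some `k > 0` as long as `‖δ‖² ≥ ε` (`exists_pos_le_dissipation`), and a nonnegative function that
never increases and, for every `ε > 0`, decreases at a positive rate while it is at least `ε`
tends to zero (`tendsto_zero_of_uniform_dissipation`).
-/

namespace SobolevDescent

open ContinuousLinearMap

/-! ### A decay criterion on the half-line -/

theorem tendsto_zero_of_uniform_dissipation {f f' : ℝ → ℝ}
    (hf : ∀ t, 0 < t → HasDerivAt f (f' t) t) (hf0 : ∀ t, 0 ≤ f t)
    (hf' : ∀ t, 0 < t → f' t ≤ 0)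
    (hdiss : ∀ ε, 0 < ε → ∃ k, 0 < k ∧ ∀ t, 0 < t → ε ≤ f t → f' t ≤ -k) :
    Tendsto f atTop (𝓝 0) := by
  have hcont : ContinuousOn f (Ioi 0) := fun t ht => (hf t ht).continuousAt.continuousWithinAt
  have hdiff : DifferentiableOn ℝ f (interior (Ioi 0)) := fun t ht =>
    (hf t (interior_subset ht)).differentiableAt.differentiableWithinAt
  have hanti : AntitoneOn f (Ioi 0) := by
    refine antitoneOn_of_deriv_nonpos (convex_Ioi 0) hcont hdiff fun t ht => ?_
    have ht' : 0 < t := interior_subset ht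
    rw [(hf t ht').deriv]
    exact hf' t ht'
  refine (tendsto_order.2 ⟨fun a ha => Eventually.of_forall fun t => ha.trans_le (hf0 t),
    fun ε hε => ?_⟩)
  obtain ⟨k, hk, hkf⟩ := hdiss ε hε
  obtain ⟨t, ht, hft⟩ : ∃ t, 0 < t ∧ f t < ε := by
    by_contra! hge
    have hmean := (convex_Ioi (0 : ℝ)).image_sub_le_mul_sub_of_deriv_le hcont hdiff (C := -k)
      (fun t ht => by
        have ht' : 0 < t := interior_subset ht
        rw [(hf t ht').deriv]
        exact hkf t ht' (hge t ht'))
    have hpos : 0 ≤ f 1 / k := div_nonneg (hf0 1) hk.le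
    -- At rate `k` the value `f 1` is used up after time `f 1 / k`.
    have h := hmean 1 (by simp) (1 + (f 1 / k + 1)) (mem_Ioi.2 (by positivity)) (by linarith)
    have h0 := hf0 (1 + (f 1 / k + 1))
    have heq : k * (f 1 / k) = f 1 := by field_simp
    nlinarith
  filter_upwards [eventually_ge_atTop t] with s hs
  exact (hanti ht (ht.trans_le hs) hs).trans_lt hft

/-! ### Regularized inversion of positive operators -/

section Positive

variable {E : Type*} [NormedAddCommGroup E] [InnerProductSpace ℝ E] {T : E →L[ℝ] E} {lam : ℝ}
  {c δ : E}

theorem mul_norm_le_of_regularized (hT : T.IsPositive) (h : T c + lam • c = δ) :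
    lam * ‖c‖ ≤ ‖δ‖ := by
  rcases (norm_nonneg c).eq_or_lt with hc | hc
  · simp [← hc]
  have h1 : inner ℝ δ c = inner ℝ (T c) c + lam * ‖c‖ ^ 2 := by
    rw [← h, inner_add_left, real_inner_smul_left, real_inner_self_eq_norm_sq]
  have h2 := hT.inner_nonneg_left c
  have h3 := real_inner_le_norm δ c
  refine le_of_mul_le_mul_right ?_ hc
  nlinarith

/-- If `(T + lam) c = δ`, then `⟪δ, T c⟫ = ‖T c‖² + lam ⟪c, T c⟫ ≥ ‖T c‖²`, while
`T δ = (T + lam) (T c)`. -/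
theorem sq_norm_apply_le_of_regularized (hT : T.IsPositive) (hlam : 0 ≤ lam)
    (h : T c + lam • c = δ) :
    ‖T δ‖ ^ 2 ≤ (‖T‖ + lam) ^ 2 * inner ℝ δ (T c) := by
  have h1 : inner ℝ δ (T c) = ‖T c‖ ^ 2 + lam * inner ℝ c (T c) := by
    rw [← h, inner_add_left, real_inner_smul_left, real_inner_self_eq_norm_sq]
  have h2 := mul_nonneg hlam (hT.inner_nonneg_right c)
  have h3 : ‖T δ‖ ≤ (‖T‖ + lam) * ‖T c‖ := by
    rw [← h, map_add, map_smul, add_mul]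
    refine (norm_add_le _ _).trans (add_le_add (T.le_opNorm _) ?_)
    rw [norm_smul, Real.norm_of_nonneg hlam]
  calc ‖T δ‖ ^ 2 ≤ ((‖T‖ + lam) * ‖T c‖) ^ 2 := by gcongr
    _ = (‖T‖ + lam) ^ 2 * ‖T c‖ ^ 2 := by ring
    _ ≤ _ := by gcongr; linarith

theorem exists_pos_le_sq_norm_div {K : Set (E × (E →L[ℝ] E))} (hK : IsCompact K) {a : E}
    (hne : ∀ p ∈ K, a - p.1 ≠ 0 → p.2 (a - p.1) ≠ 0) (hlam : 0 < lam) {ε : ℝ} (hε : 0 < ε) :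
    ∃ k, 0 < k ∧ ∀ p ∈ K, ε ≤ ‖a - p.1‖ ^ 2 → k ≤ ‖p.2 (a - p.1)‖ ^ 2 / (‖p.2‖ + lam) ^ 2 := by
  have hKε : IsCompact (K ∩ {p | ε ≤ ‖a - p.1‖ ^ 2}) :=
    hK.inter_right (isClosed_le continuous_const (by fun_prop))
  have hcont : Continuous fun p : E × (E →L[ℝ] E) =>
      ‖p.2 (a - p.1)‖ ^ 2 / (‖p.2‖ + lam) ^ 2 :=
    Continuous.div (by fun_prop) (by fun_prop) fun p => by positivity
  rcases (K ∩ {p | ε ≤ ‖a - p.1‖ ^ 2}).eq_empty_or_nonempty with hempty | hnonempty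
  · exact ⟨1, one_pos, fun p hp hpε => (notMem_empty p (hempty.subset ⟨hp, hpε⟩)).elim⟩
  obtain ⟨p, ⟨hpK, hpε⟩, hmin⟩ := hKε.exists_isMinOn hnonempty hcont.continuousOn
  refine ⟨_, ?_, fun q hq hqε => hmin ⟨hq, hqε⟩⟩
  have hp0 : a - p.1 ≠ 0 := fun h0 => by
    rw [mem_ofPred_eq, h0, norm_zero] at hpε
    linarith
  have := norm_pos_iff.2 (hne p hpK hp0)
  positivity

end Positive

/-! ### Probability measures on a compact set -/

/-- By Carathéodory's theorem, the convex hull is the union over `k ≤ finrank ℝ F + 1` of the sets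
of convex combinations of `k` points. -/
theorem isCompact_convexHull {F : Type*} [NormedAddCommGroup F] [NormedSpace ℝ F]
    [FiniteDimensional ℝ F] {s : Set F} (hs : IsCompact s) : IsCompact (convexHull ℝ s) := by
  have heq : convexHull ℝ s = ⋃ k ∈ Iic (Module.finrank ℝ F + 1),
      (fun p : (Fin k → ℝ) × (Fin k → F) => ∑ i, p.1 i • p.2 i) ''
        (stdSimplex ℝ (Fin k) ×ˢ univ.pi fun _ => s) := by
    refine Subset.antisymm (fun x hx => ?_) ?_
    · obtain ⟨ι, hι, z, w, hzs, hz, hw, hw1, rfl⟩ := eq_pos_convex_span_of_mem_convexHull hx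
      have hcard : Fintype.card ι ≤ Module.finrank ℝ F + 1 :=
        hz.card_le_finrank_succ.trans (Nat.succ_le_succ (Submodule.finrank_le _))
      let e := (Fintype.equivFin ι).symm
      refine mem_biUnion (mem_Iic.2 hcard) ⟨(w ∘ e, z ∘ e), ⟨⟨fun i => (hw _).le, ?_⟩, ?_⟩, ?_⟩
      · exact (e.sum_comp w).trans hw1
      · exact fun i _ => hzs (mem_range_self _)
      · exact e.sum_comp fun i => w i • z i
    · refine iUnion₂_subset fun k _ => ?_
      rintro _ ⟨⟨w, z⟩, ⟨⟨hw, hw1⟩, hz⟩, rfl⟩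
      exact (convex_convexHull ℝ s).sum_mem (fun i _ => hw i) hw1
        fun i _ => subset_convexHull ℝ s (hz i (mem_univ i))
  rw [heq]
  refine (finite_Iic _).isCompact_biUnion fun k _ => ?_
  exact ((isCompact_stdSimplex ℝ (Fin k)).prod (isCompact_univ_pi fun _ => hs)).image (by fun_prop)

section Moments

variable {d : ℕ} {X : Set (EuclideanSpace ℝ (Fin d))} {ν : Measure (EuclideanSpace ℝ (Fin d))}

theorem IsProbabilityOn.ae_mem (hν : IsProbabilityOn X ν) : ∀ᵐ x ∂ν, x ∈ X := by
  rw [ae_iff]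
  exact hν.compl_eq_zero

variable {F : Type*} [NormedAddCommGroup F]

theorem IsProbabilityOn.integrable (hν : IsProbabilityOn X ν) (hX : IsCompact X)
    {f : EuclideanSpace ℝ (Fin d) → F} (hf : ContinuousOn f X) : Integrable f ν := by
  have := hν.isProbabilityMeasure
  rw [← Measure.restrict_eq_self_of_ae_mem hν.ae_mem]
  exact hf.integrableOn_compact hX

theorem isProbabilityOn_dirac {x : EuclideanSpace ℝ (Fin d)} (hX : IsClosed X) (hx : x ∈ X) :
    IsProbabilityOn X (Measure.dirac x) :=
  ⟨inferInstance, by simp [Measure.dirac_apply' _ hX.measurableSet.compl, hx]⟩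

variable [NormedSpace ℝ F] [FiniteDimensional ℝ F]

/-- The vectors that are the integral of `f` against a probability measure on `X` form the convex
hull of `f '' X`; in particular they form a compact set. -/
theorem exists_integral_eq_iff_mem_convexHull (hX : IsCompact X)
    {f : EuclideanSpace ℝ (Fin d) → F} (hf : ContinuousOn f X) {p : F} :
    (∃ ν, IsProbabilityOn X ν ∧ ∫ x, f x ∂ν = p) ↔ p ∈ convexHull ℝ (f '' X) := by
  constructor
  · rintro ⟨ν, hν, rfl⟩
    have := hν.isProbabilityMeasure
    refine (convex_convexHull ℝ _).integral_mem
      (isCompact_convexHull (hX.image_of_continuousOn hf)).isClosed ?_ (hν.integrable hX hf)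
    filter_upwards [hν.ae_mem] with x hx
    exact subset_convexHull ℝ _ (mem_image_of_mem f hx)
  · refine fun hp => convexHull_min (t := {p | ∃ ν, IsProbabilityOn X ν ∧ ∫ x, f x ∂ν = p}) ?_ ?_ hp
    · rintro _ ⟨x, hx, rfl⟩
      exact ⟨_, isProbabilityOn_dirac hX.isClosed hx, integral_dirac f x⟩
    · rintro _ ⟨ν₁, h₁, rfl⟩ _ ⟨ν₂, h₂, rfl⟩ a b ha hb hab
      have := h₁.isProbabilityMeasure
      have := h₂.isProbabilityMeasure
      refine ⟨ENNReal.ofReal a • ν₁ + ENNReal.ofReal b • ν₂, ⟨⟨?_⟩, ?_⟩, ?_⟩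
      · simp [← ENNReal.ofReal_add ha hb, hab]
      · simp [h₁.compl_eq_zero, h₂.compl_eq_zero]
      · rw [integral_add_measure ((h₁.integrable hX hf).smul_measure ENNReal.ofReal_ne_top)
          ((h₂.integrable hX hf).smul_measure ENNReal.ofReal_ne_top), integral_smul_measure,
          integral_smul_measure, ENNReal.toReal_ofReal ha, ENNReal.toReal_ofReal hb]

end Moments

/-! ### The derivative Gramian as an operator -/

section Gramian

variable {d m : ℕ} {X : Set (EuclideanSpace ℝ (Fin d))}
  {Φ : EuclideanSpace ℝ (Fin d) → EuclideanSpace ℝ (Fin m)}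
  {ν νp : Measure (EuclideanSpace ℝ (Fin d))} {lam : ℝ}

/-- The operator `DΦ(x) DΦ(x)†` on `ℝᵐ`, whose matrix is `[JΦ(x)]ᵀ JΦ(x)`. The Jacobian is the
transpose of the matrix of the derivative, hence the order of the factors. -/
noncomputable def gramOperator (X : Set (EuclideanSpace ℝ (Fin d)))
    (Φ : EuclideanSpace ℝ (Fin d) → EuclideanSpace ℝ (Fin m)) (x : EuclideanSpace ℝ (Fin d)) :
    EuclideanSpace ℝ (Fin m) →L[ℝ] EuclideanSpace ℝ (Fin m) :=
  fderivWithin ℝ Φ X x ∘L adjoint (fderivWithin ℝ Φ X x)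

/-- The operator `𝔼_{x ∼ ν} DΦ(x) DΦ(x)†` on `ℝᵐ`, whose matrix is `D(ν)`. -/
noncomputable def meanGramOperator (X : Set (EuclideanSpace ℝ (Fin d)))
    (Φ : EuclideanSpace ℝ (Fin d) → EuclideanSpace ℝ (Fin m))
    (ν : Measure (EuclideanSpace ℝ (Fin d))) :
    EuclideanSpace ℝ (Fin m) →L[ℝ] EuclideanSpace ℝ (Fin m) :=
  ∫ x, gramOperator X Φ x ∂ν

theorem continuousOn_gramOperator (hXd : UniqueDiffOn ℝ X) (hΦ : ContDiffOn ℝ 1 Φ X) :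
    ContinuousOn (gramOperator X Φ) X := by
  have h := hΦ.continuousOn_fderivWithin hXd le_rfl
  exact h.clm_comp ((adjoint (𝕜 := ℝ) (E := EuclideanSpace ℝ (Fin d))
    (F := EuclideanSpace ℝ (Fin m))).continuous.comp_continuousOn h)

theorem inner_single_gramOperator_single (x : EuclideanSpace ℝ (Fin d)) (i j : Fin m) :
    inner ℝ (EuclideanSpace.single i (1 : ℝ)) (gramOperator X Φ x (EuclideanSpace.single j 1)) =
      ((jacobian X Φ x).transpose * jacobian X Φ x) i j := by
  rw [gramOperator, comp_apply, ← adjoint_inner_left,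
    ← (EuclideanSpace.basisFun (Fin d) ℝ).sum_inner_mul_inner, Matrix.mul_apply]
  refine Finset.sum_congr rfl fun a _ => ?_
  rw [adjoint_inner_left, adjoint_inner_right]
  simp [jacobian, EuclideanSpace.inner_single_left, EuclideanSpace.inner_single_right]

theorem toEuclideanLin_derivativeGramian (hν : IsProbabilityOn X ν) (hX : IsCompact X)
    (hXd : UniqueDiffOn ℝ X) (hΦ : ContDiffOn ℝ 1 Φ X) (v : EuclideanSpace ℝ (Fin m)) :
    Matrix.toEuclideanLin (derivativeGramian X Φ ν) v = meanGramOperator X Φ ν v := by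
  have hint := hν.integrable hX (continuousOn_gramOperator hXd hΦ)
  suffices Matrix.toEuclideanLin (derivativeGramian X Φ ν) = (meanGramOperator X Φ ν).toLinearMap by
    rw [this]; rfl
  refine (EuclideanSpace.basisFun (Fin m) ℝ).toBasis.ext fun j => ?_
  ext i
  have h1 : meanGramOperator X Φ ν (EuclideanSpace.single j 1) i =
      derivativeGramian X Φ ν i j := by
    have h2 : meanGramOperator X Φ ν (EuclideanSpace.single j 1) i =
        inner ℝ (EuclideanSpace.single i (1 : ℝ))
          (meanGramOperator X Φ ν (EuclideanSpace.single j 1)) := by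
      simp [EuclideanSpace.inner_single_left]
    rw [h2, meanGramOperator, integral_apply hint,
      ← integral_inner (hint.apply_continuousLinearMap _)]
    simp only [inner_single_gramOperator_single]
    rfl
  simp [h1, Matrix.toLpLin_apply]

theorem isPositive_meanGramOperator (hν : IsProbabilityOn X ν) (hX : IsCompact X)
    (hXd : UniqueDiffOn ℝ X) (hΦ : ContDiffOn ℝ 1 Φ X) : (meanGramOperator X Φ ν).IsPositive := by
  have hint := hν.integrable hX (continuousOn_gramOperator hXd hΦ)
  have hpos : ∀ x, (gramOperator X Φ x).IsPositive := fun x => isPositive_self_comp_adjoint _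
  have hinner : ∀ v w, inner ℝ v (meanGramOperator X Φ ν w) =
      ∫ x, inner ℝ v (gramOperator X Φ x w) ∂ν := fun v w => by
    rw [meanGramOperator, integral_apply hint, integral_inner (hint.apply_continuousLinearMap _)]
  refine (isPositive_iff _).2 ⟨fun v w => ?_, fun v => ?_⟩
  · rw [coe_coe, real_inner_comm, hinner, hinner]
    congr 1 with x
    rw [← (hpos x).inner_left_eq_inner_right, real_inner_comm]
  · rw [real_inner_comm, hinner]
    exact integral_nonneg fun x => (hpos x).inner_nonneg_right v

/-- The matrix inverse in the critic is a true inverse, since `D(ν) + lam` is coercive. -/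
theorem meanGramOperator_criticCoeff (hν : IsProbabilityOn X ν) (hX : IsCompact X)
    (hXd : UniqueDiffOn ℝ X) (hΦ : ContDiffOn ℝ 1 Φ X) (hlam : 0 < lam) :
    meanGramOperator X Φ ν (criticCoeff X Φ lam νp ν) + lam • criticCoeff X Φ lam νp ν =
      delta Φ νp ν := by
  have hT := isPositive_meanGramOperator hν hX hXd hΦ
  set M := derivativeGramian X Φ ν + lam • (1 : Matrix (Fin m) (Fin m) ℝ) with hM
  have hMv : ∀ v, Matrix.toEuclideanLin M v = meanGramOperator X Φ ν v + lam • v := fun v => by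
    rw [hM, map_add, LinearMap.add_apply, toEuclideanLin_derivativeGramian hν hX hXd hΦ, map_smul,
      LinearMap.smul_apply, Matrix.toLpLin_apply, Matrix.one_mulVec]
  have hunit : IsUnit M := by
    rw [← Matrix.mulVec_injective_iff_isUnit]
    refine (injective_iff_map_eq_zero M.mulVecLin).2 fun v hv => ?_
    have h0 : meanGramOperator X Φ ν (WithLp.toLp 2 v) + lam • WithLp.toLp 2 v = 0 := by
      rw [← hMv, Matrix.toLpLin_toLp]
      simpa using hv
    have h1 := mul_norm_le_of_regularized hT h0
    rw [norm_zero] at h1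
    have h2 : ‖WithLp.toLp 2 v‖ = 0 :=
      le_antisymm (nonpos_of_mul_nonpos_right h1 hlam) (norm_nonneg _)
    simpa using h2
  rw [← hMv, criticCoeff, Matrix.toLpLin_apply, Matrix.toLpLin_apply,
    Matrix.mulVec_mulVec, Matrix.mul_nonsing_inv _ ((Matrix.isUnit_iff_isUnit_det M).1 hunit),
    Matrix.one_mulVec]

theorem gradientWithin_critic (hXd : UniqueDiffOn ℝ X) (hΦ : ContDiffOn ℝ 1 Φ X)
    {x : EuclideanSpace ℝ (Fin d)} (hx : x ∈ X) :
    gradientWithin (critic X Φ lam νp ν) X x =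
      adjoint (fderivWithin ℝ Φ X x) (criticCoeff X Φ lam νp ν) := by
  have h := ((hΦ.differentiableOn one_ne_zero) x hx).hasFDerivWithinAt
  have h' : HasFDerivWithinAt (critic X Φ lam νp ν)
      (innerSL ℝ (criticCoeff X Φ lam νp ν) ∘L fderivWithin ℝ Φ X x) X x :=
    (innerSL ℝ (criticCoeff X Φ lam νp ν)).hasFDerivAt.comp_hasFDerivWithinAt x h
  refine ext_inner_right ℝ fun v => ?_
  rw [gradientWithin, InnerProductSpace.toDual_symm_apply, h'.fderivWithin (hXd x hx),
    adjoint_inner_left]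
  rfl

/-! ### Uniform dissipation away from the target -/

theorem exists_pos_le_dissipation (hX : IsCompact X) (hXd : UniqueDiffOn ℝ X)
    (hΦ : ContDiffOn ℝ 1 Φ X) (hA : AssumptionA X Φ νp) (hlam : 0 < lam) {ε : ℝ} (hε : 0 < ε) :
    ∃ k, 0 < k ∧ ∀ ν, IsProbabilityOn X ν → ε ≤ ‖delta Φ νp ν‖ ^ 2 →
      k ≤ inner ℝ (delta Φ νp ν) (meanGramOperator X Φ ν (criticCoeff X Φ lam νp ν)) := by
  have hG := continuousOn_gramOperator hXd hΦ
  have hf : ContinuousOn (fun x => (Φ x, gramOperator X Φ x)) X := hΦ.continuousOn.prodMk hG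
  have hpair : ∀ ν, IsProbabilityOn X ν →
      ∫ x, (Φ x, gramOperator X Φ x) ∂ν = (meanEmbedding Φ ν, meanGramOperator X Φ ν) :=
    fun ν hν => integral_pair (hν.integrable hX hΦ.continuousOn) (hν.integrable hX hG)
  obtain ⟨k, hk, hkν⟩ := exists_pos_le_sq_norm_div
    (isCompact_convexHull (hX.image_of_continuousOn hf)) (a := meanEmbedding Φ νp)
    (fun p hpK hp0 => by
      obtain ⟨ν, hν, rfl⟩ := (exists_integral_eq_iff_mem_convexHull hX hf).2 hpK
      rw [hpair ν hν] at hp0 ⊢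
      have hker := hA ν hν hp0
      rwa [LinearMap.mem_ker, toEuclideanLin_derivativeGramian hν hX hXd hΦ] at hker) hlam hε
  refine ⟨k, hk, fun ν hν hδ => ?_⟩
  have hmem := (exists_integral_eq_iff_mem_convexHull hX hf).1 ⟨ν, hν, hpair ν hν⟩
  refine (hkν _ hmem hδ).trans ?_
  rw [div_le_iff₀ (by positivity), mul_comm]
  exact sq_norm_apply_le_of_regularized (isPositive_meanGramOperator hν hX hXd hΦ) hlam.le
    (meanGramOperator_criticCoeff hν hX hXd hΦ hlam)

/-! ### Evolution of the mean embedding along the descent -/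

theorem exists_norm_criticCoeff_le (hX : IsCompact X) (hXd : UniqueDiffOn ℝ X)
    (hΦ : ContDiffOn ℝ 1 Φ X) (hp : IsProbabilityOn X νp) (hlam : 0 < lam) :
    ∃ C, ∀ ν, IsProbabilityOn X ν → ‖criticCoeff X Φ lam νp ν‖ ≤ C := by
  obtain ⟨B, hB⟩ := (hX.image_of_continuousOn hΦ.continuousOn).isBounded.exists_norm_le
  have hmean : ∀ ν, IsProbabilityOn X ν → ‖meanEmbedding Φ ν‖ ≤ B := fun ν hν => by
    have := hν.isProbabilityMeasure
    have h := norm_integral_le_of_norm_le_const (μ := ν) (f := Φ) (C := B)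
      (by filter_upwards [hν.ae_mem] with x hx using hB _ (mem_image_of_mem Φ hx))
    simpa [meanEmbedding] using h
  refine ⟨(B + B) / lam, fun ν hν => ?_⟩
  rw [le_div_iff₀ hlam, mul_comm]
  refine (mul_norm_le_of_regularized (isPositive_meanGramOperator hν hX hXd hΦ)
    (meanGramOperator_criticCoeff hν hX hXd hΦ hlam)).trans ?_
  exact (norm_sub_le _ _).trans (add_le_add (hmean _ hp) (hmean _ hν))

variable {νq : Measure (EuclideanSpace ℝ (Fin d))} {Ω : Type*} [MeasurableSpace Ω] {P : Measure Ω}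
  {Y : ℝ → Ω → EuclideanSpace ℝ (Fin d)}

theorem IsContinuousDescent.isProbabilityOn_map [IsProbabilityMeasure P]
    (hY : IsContinuousDescent P X Φ lam νp νq Y)
    (hX : IsCompact X) {t : ℝ} (ht : 0 ≤ t) : IsProbabilityOn X (P.map (Y t)) := by
  refine ⟨Measure.isProbabilityMeasure_map (hY.aemeasurable t ht), ?_⟩
  rw [Measure.map_apply_of_aemeasurable (hY.aemeasurable t ht) hX.measurableSet.compl]
  exact ae_iff.1 (hY.mem.mono fun ω hω => hω t ht)

theorem IsContinuousDescent.hasDerivAt_feature (hY : IsContinuousDescent P X Φ lam νp νq Y)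
    (hXd : UniqueDiffOn ℝ X) (hΦ : ContDiffOn ℝ 1 Φ X) :
    ∀ᵐ ω ∂P, ∀ t ∈ Ioi (0 : ℝ), HasDerivAt (fun s => Φ (Y s ω))
      (gramOperator X Φ (Y t ω) (criticCoeff X Φ lam νp (P.map (Y t)))) t := by
  filter_upwards [hY.mem, hY.flow] with ω hmem hflow t ht
  have ht0 : 0 ≤ t := le_of_lt ht
  have h := ((hΦ.differentiableOn one_ne_zero) _ (hmem t ht0)).hasFDerivWithinAt
  have hc := h.comp_hasDerivWithinAt t (hflow t ht0) (fun s hs => hmem s hs)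
  rw [gradientWithin_critic hXd hΦ (hmem t ht0)] at hc
  exact hc.hasDerivAt (Ici_mem_nhds ht)

theorem IsContinuousDescent.hasDerivAt_delta [IsProbabilityMeasure P]
    (hY : IsContinuousDescent P X Φ lam νp νq Y)
    (hX : IsCompact X) (hXd : UniqueDiffOn ℝ X) (hΦ : ContDiffOn ℝ 1 Φ X)
    (hp : IsProbabilityOn X νp) (hlam : 0 < lam) {t : ℝ} (ht : 0 < t) :
    HasDerivAt (fun s => delta Φ νp (P.map (Y s)))
      (-meanGramOperator X Φ (P.map (Y t)) (criticCoeff X Φ lam νp (P.map (Y t)))) t := by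
  have hG := continuousOn_gramOperator hXd hΦ
  have hprob := fun {s : ℝ} (hs : 0 ≤ s) => hY.isProbabilityOn_map hX hs
  have hΦint := fun {s : ℝ} (hs : 0 ≤ s) => (hprob hs).integrable hX hΦ.continuousOn
  have hGint := (hprob ht.le).integrable hX hG
  obtain ⟨C, hC⟩ := exists_norm_criticCoeff_le (νp := νp) hX hXd hΦ hp hlam
  obtain ⟨B, hB⟩ := (hX.image_of_continuousOn hG).isBounded.exists_norm_le
  have hderiv := (hasDerivAt_integral_of_dominated_loc_of_deriv_le (μ := P) (s := Ioi 0)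
    (F := fun s ω => Φ (Y s ω))
    (F' := fun s ω => gramOperator X Φ (Y s ω) (criticCoeff X Φ lam νp (P.map (Y s))))
    (bound := fun _ => B * C) (Ioi_mem_nhds ht)
    (by
      filter_upwards [Ioi_mem_nhds ht] with s hs
      exact (hΦint (le_of_lt hs)).aestronglyMeasurable.comp_aemeasurable
        (hY.aemeasurable s (le_of_lt hs)))
    ((hΦint ht.le).comp_aemeasurable (hY.aemeasurable t ht.le))
    ((hGint.apply_continuousLinearMap _).aestronglyMeasurable.comp_aemeasurable
      (hY.aemeasurable t ht.le))
    (by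
      filter_upwards [hY.mem] with ω hω s hs
      have hs0 : 0 ≤ s := le_of_lt hs
      have hBs := hB _ (mem_image_of_mem _ (hω s hs0))
      exact (le_opNorm _ _).trans (mul_le_mul hBs (hC _ (hprob hs0)) (norm_nonneg _)
        ((norm_nonneg _).trans hBs)))
    (integrable_const _) (hY.hasDerivAt_feature hXd hΦ)).2
  rw [← integral_map (hY.aemeasurable t ht.le)
    (f := fun x => gramOperator X Φ x (criticCoeff X Φ lam νp (P.map (Y t))))
    (hGint.apply_continuousLinearMap _).aestronglyMeasurable, ← integral_apply hGint] at hderiv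
  refine (hderiv.const_sub (meanEmbedding Φ νp)).congr_of_eventuallyEq ?_
  filter_upwards [Ioi_mem_nhds ht] with s hs
  rw [delta, meanEmbedding, meanEmbedding, integral_map (hY.aemeasurable s (le_of_lt hs))
    (hΦint (le_of_lt hs)).aestronglyMeasurable]

end Gramian

end SobolevDescent

theorem mainTheorem3 {d m : ℕ}
    (X : Set (EuclideanSpace ℝ (Fin d))) (hX : IsCompact X) (hXd : UniqueDiffOn ℝ X)
    (Φ : EuclideanSpace ℝ (Fin d) → EuclideanSpace ℝ (Fin m)) (hΦ : ContDiffOn ℝ 1 Φ X)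
    (νp νq : Measure (EuclideanSpace ℝ (Fin d)))
    (hp : SobolevDescent.IsProbabilityOn X νp) (hq : SobolevDescent.IsProbabilityOn X νq)
    (hA : SobolevDescent.AssumptionA X Φ νp)
    (lam : ℝ) (hlam : 0 < lam)
    {Ω : Type*} [MeasurableSpace Ω] (P : Measure Ω) [IsProbabilityMeasure P]
    (Y : ℝ → Ω → EuclideanSpace ℝ (Fin d))
    (hY : SobolevDescent.IsContinuousDescent P X Φ lam νp νq Y) :
    Tendsto (fun t : ℝ => SobolevDescent.MMD Φ νp (P.map (Y t))) atTop (𝓝 0) := by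
  have hprob := fun {t : ℝ} (ht : 0 < t) => hY.isProbabilityOn_map hX ht.le
  have hsq : Tendsto (fun t => ‖SobolevDescent.delta Φ νp (P.map (Y t))‖ ^ 2) atTop (𝓝 0) := by
    refine SobolevDescent.tendsto_zero_of_uniform_dissipation
      (fun t ht => (hY.hasDerivAt_delta hX hXd hΦ hp hlam ht).norm_sq) (fun t => by positivity)
      (fun t ht => ?_) (fun ε hε => ?_)
    · have h := SobolevDescent.sq_norm_apply_le_of_regularized
        (SobolevDescent.isPositive_meanGramOperator (hprob ht) hX hXd hΦ) hlam.le
        (SobolevDescent.meanGramOperator_criticCoeff (νp := νp) (hprob ht) hX hXd hΦ hlam)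
      have h0 := nonneg_of_mul_nonneg_right ((sq_nonneg _).trans h) (by positivity)
      rw [inner_neg_right]
      linarith
    · obtain ⟨k, hk, hkν⟩ := SobolevDescent.exists_pos_le_dissipation hX hXd hΦ hA hlam hε
      refine ⟨2 * k, by positivity, fun t ht hδ => ?_⟩
      have h := hkν _ (hprob ht) hδ
      rw [inner_neg_right]
      linarith
  have hsqrt := hsq.sqrt
  simp only [Real.sqrt_zero, Real.sqrt_sq (norm_nonneg _)] at hsqrt
  exact hsqrt
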